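/- Let $c_1,c_2\in(0,1)$. There are constants $c,c'>0$, depending only on $c_1$ and $c_2$, such that the following holds. Let $P$ be an irreducible reversible transition matrix on a finite nonempty state space $E$, with stationary distribution $\pi$ (reversible means $\pi(x)P(x,y)=\pi(y)P(y,x)$ for all $x,y\in E$), and let $(a(x,x))_{x\in E}$ satisfy $c_1\le a(x,x)\le c_2$ for all $x\in E$. Let $Q$ be the transition matrix of the chain which, when at $x$, stays at $x$ with probability $a(x,x)$ and otherwise, with probability $1-a(x,x)$, jumps to a state $y$ chosen with probability $P(x,y)$, i.e. $Q(x,y)=a(x,x)\mathbf 1_{\{x=y\}}+(1-a(x,x))P(x,y)$, and let $\widetilde\pi$ be the stationary distribution of $Q$. Set $$t_{\mathrm{mix}}(Q)=\min\Big\{t\ge 0:\max_{x\in E}\|Q^t(x,\cdot)-\widetilde\pi\|\le \tfrac14\Big\},\qquad t_{\mathrm L}=\min\Big\{t\ge 0:\max_{x\in E}\Big\|\Big(\tfrac{P+I}{2}\Big)^t(x,\cdot)-\pi\Big\|\le \tfrac14\Big\},$$ where $\|\mu-\nu\|=\frac12\sum_x|\mu(x)-\nu(x)|$ is the total variation distance.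 Then both minima exist (the sets are nonempty), and $$c\,t_{\mathrm L}\le t_{\mathrm{mix}}(Q)\le c'\,t_{\mathrm L}.$$ -/

import Mathlib

universe u

noncomputable section

namespace MarkovMixing

/-- `π` is a stationary (probability) distribution of the transition matrix `P` : `π P = π`. -/
structure IsStationary {E : Type*} [Fintype E] (P : Matrix E E ℝ) (π : E → ℝ) : Prop where
  nonneg : ∀ x, 0 ≤ π x
  sum_eq_one : ∑ x, π x = 1
  vecMul_eq : Matrix.vecMul π P = π

/-- The stationary distribution of `P` (it exists and is unique when `P` is a row-stochastic
irreducible matrix on a finite nonempty state space). -/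
def stationaryDistribution {E : Type*} [Fintype E] (P : Matrix E E ℝ) : E → ℝ :=
  Classical.epsilon (IsStationary P)

/-- `P` is reversible: it satisfies the detailed balance equations with respect to
a stationary distribution. -/
def IsReversible {E : Type*} [Fintype E] (P : Matrix E E ℝ) : Prop :=
  ∃ π : E → ℝ, IsStationary P π ∧ ∀ x y, π x * P x y = π y * P y x

/-- Total variation distance between two probability vectors on a finite set. -/
def tvDist {E : Type*} [Fintype E] (μ ν : E → ℝ) : ℝ :=
  (1 / 2) * ∑ x, |μ x - ν x|

/-- The worst-case distance `max_x ‖K ^ t (x, ·) - π‖` after `t` steps of the chain `K`. -/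
def worstDist {E : Type*} [Fintype E] [DecidableEq E] (K : Matrix E E ℝ) (π : E → ℝ)
    (t : ℕ) : ℝ :=
  ⨆ x, tvDist ((K ^ t) x) π

/-- The mixing time `t_mix(ε) = min {t : d(t) ≤ ε}` of the transition matrix `P`. -/
def mixingTime {E : Type*} [Fintype E] [DecidableEq E] (P : Matrix E E ℝ) (ε : ℝ) : ℕ :=
  sInf {t : ℕ | worstDist P (stationaryDistribution P) t ≤ ε}

/-- The transition matrix `(P + I) / 2` of the lazy version of the chain. -/
def lazyVersion {E : Type*} [DecidableEq E] (P : Matrix E E ℝ) : Matrix E E ℝ :=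
  (1 / 2 : ℝ) • (P + 1)

/-- The mixing time `t_L(ε)` of the lazy version of the chain, measured with respect to
the stationary distribution of `P`. -/
def lazyMixingTime {E : Type*} [Fintype E] [DecidableEq E] (P : Matrix E E ℝ) (ε : ℝ) : ℕ :=
  sInf {t : ℕ | worstDist (lazyVersion P) (stationaryDistribution P) t ≤ ε}

/-- The transition matrix of the chain which at `x` holds with probability `a x` and, with
probability `1 - a x`, moves to a state `y` chosen with probability `P x y`. -/
def holdingChain {E : Type*} [DecidableEq E] (P : Matrix E E ℝ) (a : E → ℝ) : Matrix E E ℝ :=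
  Matrix.of fun x y => (if y = x then a x else 0) + (1 - a x) * P x y

end MarkovMixing

end

noncomputable section

namespace MarkovMixing

open Finset Matrix Filter Topology

/-! The lazy chain and the holding chain are both holding chains of `P`, and two such chains `Q`,
`R` satisfy `I - R = g (I - Q)` with `g` bounded above and below and with comparable stationary
measures `μ`, `ν`. It is enough to show that if `Q` has mixed by time `T`, then `R` has mixed by a
bounded multiple of `T`. Exchanging the roles of the chains gives the other inequality.

A spectral gap alone would cost a factor logarithmic in the smallest stationary mass, so it is
combined with exit times. Mixing of `Q` gives a Poincaré inequality with constant of order `T`. It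
transfers to `R`, whose holding keeps its spectrum away from `-1` (`IsTimeChange.eq_const_or_gap`).
For `|f| ≤ 1` of mean zero, a maximal inequality in `L²(ν)` then shows that `R^t f` is small
throughout the window `mT ≤ t ≤ 2mT`, outside a set `B` of small measure
(`IsTimeChange.sum_windowBound_le`).

From any point, `Q` leaves `B` by time `T` with probability at least 1/2. The truncated expected
exit time of `Q` is a Lyapunov function, and `I - R = g (I - Q)` carries its drift over to `R`,
which therefore leaves `B` in expected time of order `T` (`IsTimeChange.mul_survival_le`). Stopping
on exit from `B`, where the function is small for all remaining times of the window, bounds `R^(2mT)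
f` everywhere (`IsTimeChange.worstDist_le`). -/

variable {E : Type*} [Fintype E]

/-! ### Reversible chains in weighted `L²` -/

/-- The inner product of `L²(π)`. -/
def weightedInner (π f g : E → ℝ) : ℝ := ∑ x, π x * f x * g x

lemma weightedInner_comm (π f g : E → ℝ) : weightedInner π f g = weightedInner π g f :=
  sum_congr rfl fun x _ => by ring

lemma weightedInner_smul_left (π f g : E → ℝ) (c : ℝ) :
    weightedInner π (c • f) g = c * weightedInner π f g := by
  simp only [weightedInner, mul_sum, Pi.smul_apply, smul_eq_mul]
  exact sum_congr rfl fun x _ => by ring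

lemma weightedInner_sub_left (π f f' g : E → ℝ) :
    weightedInner π (f - f') g = weightedInner π f g - weightedInner π f' g := by
  simp only [weightedInner, ← sum_sub_distrib, Pi.sub_apply]
  exact sum_congr rfl fun x _ => by ring

lemma weightedInner_smul_right (π f g : E → ℝ) (c : ℝ) :
    weightedInner π f (c • g) = c * weightedInner π f g := by
  rw [weightedInner_comm, weightedInner_smul_left, weightedInner_comm]

lemma weightedInner_sub_right (π f g g' : E → ℝ) :
    weightedInner π f (g - g') = weightedInner π f g - weightedInner π f g' := by
  rw [weightedInner_comm, weightedInner_sub_left, weightedInner_comm, weightedInner_comm _ g']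

variable [DecidableEq E]

/-- `K` is a transition matrix in detailed balance with the positive probability vector `π`. -/
structure IsReversibleWrt (K : Matrix E E ℝ) (π : E → ℝ) : Prop where
  stochastic : K ∈ rowStochastic ℝ E
  pos : ∀ x, 0 < π x
  sum_eq_one : ∑ x, π x = 1
  balance : ∀ x y, π x * K x y = π y * K y x

lemma mulVec_mono {K : Matrix E E ℝ} (hK : K ∈ rowStochastic ℝ E) {f g : E → ℝ}
    (h : ∀ x, f x ≤ g x) (x : E) : (K *ᵥ f) x ≤ (K *ᵥ g) x :=
  sum_le_sum fun y _ => mul_le_mul_of_nonneg_left (h y) (hK.1 x y)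

lemma mulVec_const {K : Matrix E E ℝ} (hK : K ∈ rowStochastic ℝ E) (c : ℝ) :
    K *ᵥ (fun _ => c) = fun _ => c := by
  ext x
  simp [mulVec, dotProduct, ← sum_mul, sum_row_of_mem_rowStochastic hK]

lemma abs_mulVec_le {K : Matrix E E ℝ} (hK : K ∈ rowStochastic ℝ E) {f : E → ℝ} {c : ℝ}
    (h : ∀ x, |f x| ≤ c) (x : E) : |(K *ᵥ f) x| ≤ c := by
  have h1 := mulVec_mono hK (fun x => (abs_le.1 (h x)).2) x
  have h2 := mulVec_mono hK (fun x => (abs_le.1 (h x)).1) x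
  rw [mulVec_const hK c] at h1
  rw [mulVec_const hK (-c)] at h2
  exact abs_le.2 ⟨h2, h1⟩

lemma pow_mulVec_eigenvector {K : Matrix E E ℝ} {φ : E → ℝ} {l : ℝ} (h : K *ᵥ φ = l • φ) (t : ℕ) :
    (K ^ t) *ᵥ φ = l ^ t • φ := by
  induction t with
  | zero => simp
  | succ t ih => rw [pow_succ, ← mulVec_mulVec, h, mulVec_smul, ih, smul_smul, pow_succ, mul_comm]

namespace IsReversibleWrt

variable {K : Matrix E E ℝ} {π : E → ℝ}

lemma weightedInner_mulVec (h : IsReversibleWrt K π) (f g : E → ℝ) :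
    weightedInner π (K *ᵥ f) g = weightedInner π f (K *ᵥ g) := by
  simp only [weightedInner, mulVec, dotProduct, mul_sum, sum_mul]
  rw [sum_comm]
  refine sum_congr rfl fun x _ => sum_congr rfl fun y _ => ?_
  linear_combination (f x * g y) * h.balance y x

lemma weightedInner_one_mulVec (h : IsReversibleWrt K π) (f : E → ℝ) :
    weightedInner π (K *ᵥ f) 1 = weightedInner π f 1 := by
  rw [h.weightedInner_mulVec, h.stochastic.2]

lemma pow (h : IsReversibleWrt K π) (t : ℕ) : IsReversibleWrt (K ^ t) π := by
  refine ⟨pow_mem h.stochastic t, h.pos, h.sum_eq_one, ?_⟩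
  induction t with
  | zero =>
    intro x y
    by_cases hxy : x = y
    · subst hxy; rfl
    · simp [one_apply, hxy, Ne.symm hxy]
  | succ t ih =>
    intro x y
    rw [pow_succ, mul_apply, ← pow_succ, pow_succ', mul_apply, mul_sum, mul_sum]
    refine sum_congr rfl fun z _ => ?_
    rw [← mul_assoc, ih, mul_right_comm, h.balance, mul_assoc]

lemma isStationary (h : IsReversibleWrt K π) : IsStationary K π := by
  refine ⟨fun x => (h.pos x).le, h.sum_eq_one, ?_⟩
  ext y
  simp only [vecMul, dotProduct]
  rw [sum_congr rfl fun x _ => h.balance x y, ← mul_sum,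
    sum_row_of_mem_rowStochastic h.stochastic, mul_one]

lemma weightedInner_const_one (h : IsReversibleWrt K π) (c : ℝ) :
    weightedInner π (fun _ => c) 1 = c := by
  simp [weightedInner, ← sum_mul, h.sum_eq_one]

lemma weightedInner_self_pos (h : IsReversibleWrt K π) {f : E → ℝ} (hf : f ≠ 0) :
    0 < weightedInner π f f := by
  obtain ⟨x, hx⟩ := Function.ne_iff.1 hf
  refine sum_pos' (fun x _ => ?_) ⟨x, mem_univ _, ?_⟩
  · rw [mul_assoc]; exact mul_nonneg (h.pos x).le (mul_self_nonneg _)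
  · rw [mul_assoc]; exact mul_pos (h.pos x) (mul_self_pos.2 hx)

/-- Diagonalization of a reversible chain in `L²(π)`, in the form of Parseval's identity for
a family of eigenfunctions. -/
lemma exists_eigenfunctions (h : IsReversibleWrt K π) :
    ∃ (l : E → ℝ) (φ : E → E → ℝ), (∀ i, K *ᵥ φ i = l i • φ i) ∧
      ∀ f g, weightedInner π f g = ∑ i, weightedInner π f (φ i) * weightedInner π g (φ i) := by
  have hs : ∀ x, 0 < √(π x) := fun x => Real.sqrt_pos.2 (h.pos x)
  have hss : ∀ x, √(π x) * √(π x) = π x := fun x => Real.mul_self_sqrt (h.pos x).le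
  -- Detailed balance makes the conjugate of `K` by `√π` symmetric; dividing its orthonormal
  -- eigenvectors by `√π` gives the eigenfunctions.
  let S : Matrix E E ℝ := Matrix.of fun x y => √(π x) * K x y / √(π y)
  have hS : S.IsHermitian := by
    ext x y
    simp only [S, conjTranspose_apply, of_apply, star_trivial]
    rw [div_eq_div_iff (hs _).ne' (hs _).ne']
    have := h.balance x y
    rw [← hss x, ← hss y] at this
    linarith
  let v := hS.eigenvectorBasis
  have key : ∀ (f : E → ℝ) (i : E),
      weightedInner π f (fun x => v i x / √(π x)) =
        inner ℝ (WithLp.toLp 2 fun x => √(π x) * f x) (v i) := by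
    intro f i
    simp only [weightedInner, PiLp.inner_apply, RCLike.inner_apply, conj_trivial]
    refine sum_congr rfl fun x _ => ?_
    rw [mul_div_assoc', div_eq_iff (hs x).ne']
    linear_combination (-(f x * v i x)) * hss x
  refine ⟨hS.eigenvalues, fun i x => v i x / √(π x), fun i => ?_, fun f g => ?_⟩
  · ext x
    have := congrFun (hS.mulVec_eigenvectorBasis i) x
    simp only [mulVec, dotProduct, S, of_apply, Pi.smul_apply, smul_eq_mul] at this ⊢
    rw [← mul_div_assoc, ← this, eq_div_iff (hs x).ne', sum_mul]
    refine sum_congr rfl fun y _ => ?_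
    ring
  · have := v.sum_inner_mul_inner (WithLp.toLp 2 fun x => √(π x) * f x)
      (WithLp.toLp 2 fun x => √(π x) * g x)
    simp only [key]
    rw [show weightedInner π f g = inner ℝ (WithLp.toLp 2 fun x => √(π x) * f x)
      (WithLp.toLp 2 fun x => √(π x) * g x) from ?_, ← this]
    · exact sum_congr rfl fun i _ => by
        rw [real_inner_comm (v i) (WithLp.toLp 2 fun x => √(π x) * g x)]
    · simp only [weightedInner, PiLp.inner_apply, RCLike.inner_apply, conj_trivial]
      refine sum_congr rfl fun x _ => ?_
      nth_rw 1 [← hss x]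
      ring

lemma weightedInner_pow_eigenfunction (h : IsReversibleWrt K π) {φ : E → ℝ} {l : ℝ}
    (hφ : K *ᵥ φ = l • φ) (f : E → ℝ) (t : ℕ) :
    weightedInner π ((K ^ t) *ᵥ f) φ = l ^ t * weightedInner π f φ := by
  rw [(h.pow t).weightedInner_mulVec, pow_mulVec_eigenvector hφ, weightedInner_smul_right]

end IsReversibleWrt

/-! ### Total variation -/

lemma abs_pow_mulVec_sub_le {K : Matrix E E ℝ} {π f : E → ℝ} {t : ℕ} {c ε : ℝ}
    (hd : worstDist K π t ≤ ε) (hf : ∀ x, |f x| ≤ c) (hc : 0 ≤ c) (x : E) :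
    |((K ^ t) *ᵥ f) x - ∑ y, π y * f y| ≤ 2 * ε * c := by
  have h1 : tvDist ((K ^ t) x) π ≤ ε :=
    (le_ciSup (f := fun x => tvDist ((K ^ t) x) π) (Set.finite_range _).bddAbove x).trans hd
  calc |((K ^ t) *ᵥ f) x - ∑ y, π y * f y| = |∑ y, ((K ^ t) x y - π y) * f y| := by
        simp only [mulVec, dotProduct, sub_mul, sum_sub_distrib]
    _ ≤ ∑ y, |(K ^ t) x y - π y| * c := by
        refine (abs_sum_le_sum_abs _ _).trans (sum_le_sum fun y _ => ?_)
        rw [abs_mul]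
        exact mul_le_mul_of_nonneg_left (hf y) (abs_nonneg _)
    _ = 2 * tvDist ((K ^ t) x) π * c := by rw [← sum_mul, tvDist]; ring
    _ ≤ 2 * ε * c := by gcongr

/-- By duality, total variation is attained at half the sign of the difference. Centering that sign
and then halving keeps it bounded by 1, so mean-zero test functions suffice. -/
lemma worstDist_le_of_forall [Nonempty E] {K : Matrix E E ℝ} {π : E → ℝ} {t : ℕ} {ε : ℝ}
    (hK : IsReversibleWrt K π)
    (h : ∀ f : E → ℝ, (∀ x, |f x| ≤ 1) → weightedInner π f 1 = 0 →
      ∀ x, |((K ^ t) *ᵥ f) x| ≤ ε) : worstDist K π t ≤ ε := by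
  refine ciSup_le fun x => ?_
  let g : E → ℝ := fun y => SignType.sign ((K ^ t) x y - π y)
  have hg : ∀ y, |g y| ≤ 1 := by
    intro y
    rcases lt_trichotomy ((K ^ t) x y - π y) 0 with h | h | h <;> simp [g, h]
  let m := weightedInner π g 1
  have hm : |m| ≤ 1 := by
    calc |m| ≤ ∑ y, |π y * g y * 1| := abs_sum_le_sum_abs _ _
      _ ≤ ∑ y, π y := sum_le_sum fun y _ => by
        rw [mul_one, abs_mul, abs_of_pos (hK.pos y)]
        exact mul_le_of_le_one_right (hK.pos y).le (hg y)
      _ = 1 := hK.sum_eq_one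
  have := h ((1 / 2 : ℝ) • (g - fun _ => m)) (fun y => ?_) ?_ x
  · refine le_trans (le_of_eq ?_) ((le_abs_self _).trans this)
    rw [mulVec_smul, mulVec_sub, mulVec_const (hK.pow t).stochastic]
    simp only [Pi.smul_apply, Pi.sub_apply, smul_eq_mul, tvDist, m, weightedInner, mulVec,
      dotProduct, ← sum_sub_distrib, Pi.one_apply, mul_one]
    congr 1
    refine sum_congr rfl fun y _ => ?_
    rw [← sub_mul]
    exact (self_mul_sign _).symm
  · simp only [Pi.smul_apply, Pi.sub_apply, smul_eq_mul]
    have h1 := abs_le.1 (hg y)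
    have h2 := abs_le.1 hm
    exact abs_le.2 ⟨by linarith, by linarith⟩
  · rw [weightedInner_smul_left, weightedInner_sub_left, hK.weightedInner_const_one, sub_self,
      mul_zero]

/-- Gershgorin's argument at a point where `|φ|` is maximal. -/
lemma eigenvalue_mem_Icc [Nonempty E] {K : Matrix E E ℝ} (hK : K ∈ rowStochastic ℝ E)
    {c l : ℝ} (hc : ∀ x, c ≤ K x x) {φ : E → ℝ} (hφ : K *ᵥ φ = l • φ) (h0 : φ ≠ 0) :
    2 * c - 1 ≤ l ∧ l ≤ 1 := by
  obtain ⟨x, hx⟩ := Finite.exists_max fun x => |φ x|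
  have hpos : 0 < |φ x| := by
    obtain ⟨y, hy⟩ := Function.ne_iff.1 h0
    exact (abs_pos.2 hy).trans_le (hx y)
  have h1 : (l - K x x) * φ x = ∑ y ∈ univ.erase x, K x y * φ y := by
    have := congrFun hφ x
    simp only [mulVec, dotProduct, Pi.smul_apply, smul_eq_mul] at this
    rw [← add_sum_erase _ _ (mem_univ x)] at this
    linarith
  have h2 : 1 - K x x = ∑ y ∈ univ.erase x, K x y := by
    have := sum_row_of_mem_rowStochastic hK x
    rw [← add_sum_erase _ _ (mem_univ x)] at this
    linarith
  have h3 : |l - K x x| * |φ x| ≤ (1 - K x x) * |φ x| := by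
    rw [← abs_mul, h1, h2, sum_mul]
    refine (abs_sum_le_sum_abs _ _).trans (sum_le_sum fun y _ => ?_)
    rw [abs_mul, abs_of_nonneg (hK.1 x y)]
    exact mul_le_mul_of_nonneg_left (hx y) (hK.1 x y)
  have h4 := abs_le.1 (le_of_mul_le_mul_right h3 hpos)
  have := hc x
  exact ⟨by linarith, by linarith⟩

/-! ### Spectral consequences of mixing -/

namespace IsReversibleWrt

variable {K : Matrix E E ℝ} {π : E → ℝ}

/-- Centering an eigenfunction of a reversible chain gives an eigenfunction for the same
eigenvalue. -/
lemma mulVec_center (h : IsReversibleWrt K π) {φ : E → ℝ} {l : ℝ} (hφ : K *ᵥ φ = l • φ) :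
    K *ᵥ (φ - fun _ => weightedInner π φ 1) = l • (φ - fun _ => weightedInner π φ 1) := by
  have h1 := h.weightedInner_one_mulVec φ
  rw [hφ, weightedInner_smul_left] at h1
  rw [mulVec_sub, hφ, mulVec_const h.stochastic]
  ext x
  simp only [Pi.sub_apply, Pi.smul_apply, smul_eq_mul]
  linarith

lemma weightedInner_center_one (h : IsReversibleWrt K π) (φ : E → ℝ) :
    weightedInner π (φ - fun _ => weightedInner π φ 1) 1 = 0 := by
  rw [weightedInner_sub_left, h.weightedInner_const_one, sub_self]

/-- The centered eigenfunction is tested at a maximum of its absolute value, where `K ^ T`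
multiplies it by `l ^ T`. The first alternative is needed because the eigenfunction family does not
single out the constants. -/
lemma eq_const_or_abs_eigenvalue_pow_le [Nonempty E] (h : IsReversibleWrt K π) {T : ℕ}
    (hd : worstDist K π T ≤ 1 / 4) {φ : E → ℝ} {l : ℝ} (hφ : K *ᵥ φ = l • φ) :
    (φ - fun _ => weightedInner π φ 1) = 0 ∨ |l| ^ T ≤ 1 / 2 := by
  set ψ := φ - fun _ => weightedInner π φ 1 with hψ
  refine or_iff_not_imp_left.2 fun h0 => ?_
  obtain ⟨x, hx⟩ := Finite.exists_max fun x => |ψ x|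
  have hpos : 0 < |ψ x| := by
    obtain ⟨y, hy⟩ := Function.ne_iff.1 h0
    exact (abs_pos.2 hy).trans_le (hx y)
  have h1 := abs_pow_mulVec_sub_le hd hx (abs_nonneg _) x
  have h2 : ∑ y, π y * ψ y = 0 := by
    have := h.weightedInner_center_one φ
    rw [← hψ] at this
    simpa [weightedInner] using this
  rw [h2, sub_zero, pow_mulVec_eigenvector (h.mulVec_center hφ)] at h1
  simp only [Pi.smul_apply, smul_eq_mul, abs_mul, abs_pow] at h1
  refine le_of_mul_le_mul_right (h1.trans_eq ?_) hpos
  ring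

/-- A mixing chain satisfies a Poincaré inequality. -/
lemma poincare [Nonempty E] (h : IsReversibleWrt K π) {T : ℕ} (hT : 1 ≤ T)
    (hd : worstDist K π T ≤ 1 / 4) {f : E → ℝ} (hf : weightedInner π f 1 = 0) :
    weightedInner π f f ≤ 2 * T * weightedInner π (f - K *ᵥ f) f := by
  obtain ⟨l, φ, hφ, hP⟩ := h.exists_eigenfunctions
  have hT0 : (0 : ℝ) < T := by exact_mod_cast hT
  rw [hP f f, hP _ f, mul_sum]
  refine sum_le_sum fun i _ => ?_
  have h1 : weightedInner π (K *ᵥ f) (φ i) = l i * weightedInner π f (φ i) := by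
    rw [h.weightedInner_mulVec, hφ, weightedInner_smul_right]
  rw [weightedInner_sub_left, h1]
  rcases h.eq_const_or_abs_eigenvalue_pow_le hd (hφ i) with h0 | hl
  · have : weightedInner π f (φ i) = 0 := by
      rw [sub_eq_zero.1 h0,
        show (fun _ : E => weightedInner π (φ i) 1) = weightedInner π (φ i) 1 • (1 : E → ℝ) by
          ext; simp, weightedInner_smul_right, hf, mul_zero]
    simp [this]
  -- Otherwise `l i > 1 - 1 / (2T)`, and Bernoulli's inequality gives `|l i| ^ T > 1 / 2`.
  · have h2 : 1 ≤ 2 * T * (1 - l i) := by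
      by_contra hcon
      push Not at hcon
      have hl1 : 1 + -(1 / (2 * T)) < l i := by
        have : 1 - l i < 1 / (2 * T) := by rw [lt_div_iff₀ (by positivity)]; linarith
        linarith
      have hT2 : 1 / (2 * (T : ℝ)) ≤ 1 / 2 := by
        apply one_div_le_one_div_of_le (by norm_num)
        have : (1 : ℝ) ≤ T := by exact_mod_cast hT
        linarith
      have hb := one_add_mul_le_pow (a := -(1 / (2 * (T : ℝ)))) (by linarith) T
      have hc : (1 + -(1 / (2 * (T : ℝ)))) ^ T < |l i| ^ T :=
        pow_lt_pow_left₀ (hl1.trans_le (le_abs_self _)) (by linarith) (by omega)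
      have : (T : ℝ) * -(1 / (2 * T)) = -(1 / 2) := by field_simp
      linarith
    nlinarith [mul_self_nonneg (weightedInner π f (φ i))]

end IsReversibleWrt

/-! ### Transfer of the spectral gap under a time change -/

/-- The mean is the best constant approximation in `L²(π)`. This permits recentering when the
measure changes. -/
lemma weightedInner_self_le_center {K : Matrix E E ℝ} {π f : E → ℝ} (h : IsReversibleWrt K π)
    (hf : weightedInner π f 1 = 0) (m : ℝ) :
    weightedInner π f f ≤ weightedInner π (f - fun _ => m) (f - fun _ => m) := by
  have hm : (fun _ : E => m) = m • (1 : E → ℝ) := by ext; simp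
  have h1 : weightedInner π (1 : E → ℝ) 1 = 1 := h.weightedInner_const_one 1
  rw [hm]
  simp only [weightedInner_sub_left, weightedInner_sub_right, weightedInner_smul_left,
    weightedInner_smul_right, hf, h1, weightedInner_comm π 1 f]
  nlinarith [mul_self_nonneg m]

omit [DecidableEq E] in
lemma weightedInner_self_le_of_le {π π' : E → ℝ} {C : ℝ} (h : ∀ x, π x ≤ C * π' x) (f : E → ℝ) :
    weightedInner π f f ≤ C * weightedInner π' f f := by
  simp only [weightedInner, mul_sum]
  refine sum_le_sum fun x _ => ?_
  have := mul_le_mul_of_nonneg_right (h x) (mul_self_nonneg (f x))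
  linarith

/-- The chain `R` is a bounded time change of the chain `Q`, and `R` is uniformly lazy. -/
structure IsTimeChange (Q R : Matrix E E ℝ) (μ ν g : E → ℝ) (C c : ℝ) : Prop where
  left : IsReversibleWrt Q μ
  right : IsReversibleWrt R ν
  sub_mulVec : ∀ f x, (f - R *ᵥ f) x = g x * (f - Q *ᵥ f) x
  one_le : 1 ≤ C
  rate_le : ∀ x, g x ≤ C
  le_rate : ∀ x, 1 ≤ C * g x
  left_le : ∀ x, μ x ≤ C * ν x
  right_le : ∀ x, ν x ≤ C * μ x
  lazy_pos : 0 < c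
  lazy_lt : c < 1
  lazy : ∀ x, c ≤ R x x

namespace IsTimeChange

variable {Q R : Matrix E E ℝ} {μ ν g : E → ℝ} {C c : ℝ}

lemma rate_pos (h : IsTimeChange Q R μ ν g C c) (x : E) : 0 < g x := by
  have h1 := h.le_rate x
  have h2 := h.one_le
  by_contra hcon
  push Not at hcon
  nlinarith

/-- If `Q` has mixed by time `T`, then `R` has an absolute spectral gap of order `1 / T`. -/
lemma eq_const_or_gap [Nonempty E] (h : IsTimeChange Q R μ ν g C c) {T : ℕ} (hT : 1 ≤ T)
    (hd : worstDist Q μ T ≤ 1 / 4) {φ : E → ℝ} {l : ℝ} (hφ : R *ᵥ φ = l • φ) :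
    (φ - fun _ => weightedInner ν φ 1) = 0 ∨
      (2 * c ≤ 1 + l ∧ l ≤ 1 ∧ |l| ≤ 1 - c / (2 * C ^ 3) / T) := by
  have hφ' := h.right.mulVec_center hφ
  have h1 := h.right.weightedInner_center_one φ
  set ψ := φ - fun _ => weightedInner ν φ 1 with hψ
  refine or_iff_not_imp_left.2 fun h0 => ?_
  obtain ⟨hl, hl1⟩ := eigenvalue_mem_Icc h.right.stochastic h.lazy hφ' h0
  have hT1 : (1 : ℝ) ≤ T := by exact_mod_cast hT
  have hC := h.one_le
  have hc := h.lazy_pos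
  refine ⟨by linarith, hl1, ?_⟩
  let m := weightedInner μ ψ 1
  -- `ψ` has mean zero for `ν` but not for `μ`, so it is recentered by `m`; the Dirichlet form of
  -- `Q` does not see this constant.
  have hp := h.left.poincare hT hd (h.left.weightedInner_center_one ψ)
  have hsub : (ψ - fun _ => m) - Q *ᵥ (ψ - fun _ => m) = ψ - Q *ᵥ ψ := by
    rw [mulVec_sub, mulVec_const h.left.stochastic]; abel
  have hright : weightedInner μ (ψ - Q *ᵥ ψ) (ψ - fun _ => m) =
      weightedInner μ (ψ - Q *ᵥ ψ) ψ := by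
    rw [weightedInner_sub_right, show (fun _ : E => m) = m • (1 : E → ℝ) by ext; simp,
      weightedInner_smul_right, weightedInner_sub_left μ ψ (Q *ᵥ ψ) 1, h.left.weightedInner_one_mulVec,
      sub_self, mul_zero, sub_zero]
  rw [hsub, hright] at hp
  -- Pointwise, `(1 - l) ψ = g (ψ - Qψ)` and `1 / g ≤ C`.
  have h2 : weightedInner μ (ψ - Q *ᵥ ψ) ψ ≤ (1 - l) * C * weightedInner μ ψ ψ := by
    simp only [weightedInner, mul_sum]
    refine sum_le_sum fun x _ => ?_
    have h3 := h.sub_mulVec ψ x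
    rw [hφ'] at h3
    simp only [Pi.sub_apply, Pi.smul_apply, smul_eq_mul] at h3
    have h4 : (ψ - Q *ᵥ ψ) x * ψ x ≤ (1 - l) * C * (ψ x * ψ x) := by
      have hg := h.rate_pos x
      refine le_of_mul_le_mul_left ?_ hg
      calc g x * ((ψ - Q *ᵥ ψ) x * ψ x) = (1 - l) * (ψ x * ψ x) * 1 := by
            simp only [Pi.sub_apply]; linear_combination (-ψ x) * h3
        _ ≤ (1 - l) * (ψ x * ψ x) * (C * g x) :=
            mul_le_mul_of_nonneg_left (h.le_rate x)
              (mul_nonneg (by linarith) (mul_self_nonneg _))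
        _ = g x * ((1 - l) * C * (ψ x * ψ x)) := by ring
    have := mul_le_mul_of_nonneg_left h4 (h.left.pos x).le
    linarith
  have h5 := weightedInner_self_le_center h.right h1 m
  have h6 := weightedInner_self_le_of_le h.right_le (ψ - fun _ => m)
  have h7 := weightedInner_self_le_of_le h.left_le ψ
  have h8 := h.right.weightedInner_self_pos h0
  -- Of the three factors `C`, one comes from the rate and two from exchanging `μ` and `ν`.
  have h9 : weightedInner ν ψ ψ * 1 ≤ weightedInner ν ψ ψ * (2 * T * (1 - l) * C ^ 3) := by
    calc weightedInner ν ψ ψ * 1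
        ≤ C * (2 * T * ((1 - l) * C * (C * weightedInner ν ψ ψ))) := by
          rw [mul_one]
          refine (h5.trans h6).trans (mul_le_mul_of_nonneg_left (hp.trans ?_) (by linarith))
          refine mul_le_mul_of_nonneg_left (h2.trans ?_) (by positivity)
          exact mul_le_mul_of_nonneg_left h7 (mul_nonneg (by linarith) (by linarith))
      _ = _ := by ring
  have h10 := le_of_mul_le_mul_left h9 h8
  have hC3 : 1 ≤ C ^ 3 := one_le_pow₀ hC
  have h11 : c / (2 * C ^ 3) / T ≤ 1 - l := by
    rw [div_div, div_le_iff₀ (by positivity)]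
    linarith [h.lazy_lt]
  -- This handles the negative end of the spectrum, where holding gives `-l ≤ 1 - 2c`.
  have h12 : c / (2 * C ^ 3) / T ≤ 2 * c := by
    rw [div_div, div_le_iff₀ (by positivity)]
    have : 1 ≤ 2 * C ^ 3 * T := by nlinarith
    nlinarith
  exact abs_le.2 ⟨by linarith, by linarith⟩

end IsTimeChange

/-! ### Survival probabilities -/

/-- The probability that the chain `K` started from `x` stays in `B` up to time `n`. -/
def survival (K : Matrix E E ℝ) (B : Set E) : ℕ → E → ℝ
  | 0 => B.indicator 1
  | n + 1 => B.indicator (K *ᵥ survival K B n)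

section survival

variable {K : Matrix E E ℝ} {B : Set E}

omit [DecidableEq E] in
lemma survival_of_notMem {x : E} (hx : x ∉ B) (n : ℕ) : survival K B n x = 0 := by
  cases n <;> exact Set.indicator_of_notMem hx _

omit [DecidableEq E] in
lemma survival_succ_of_mem {x : E} (hx : x ∈ B) (n : ℕ) :
    survival K B (n + 1) x = (K *ᵥ survival K B n) x := Set.indicator_of_mem hx _

lemma survival_nonneg (hK : K ∈ rowStochastic ℝ E) (n : ℕ) (x : E) : 0 ≤ survival K B n x := by
  induction n generalizing x with
  | zero => exact Set.indicator_nonneg (fun _ _ => zero_le_one) x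
  | succ n ih =>
    exact Set.indicator_nonneg (fun y _ => nonneg_mulVec_of_mem_rowStochastic hK ih y) x

lemma survival_succ_le (hK : K ∈ rowStochastic ℝ E) (n : ℕ) (x : E) :
    survival K B (n + 1) x ≤ survival K B n x := by
  by_cases hx : x ∈ B
  · induction n generalizing x with
    | zero =>
      rw [survival_succ_of_mem hx]
      have := mulVec_mono hK (f := survival K B 0) (g := fun _ => 1)
        (fun y => Set.indicator_apply_le' (fun _ => le_rfl) fun _ => zero_le_one) x
      rw [mulVec_const hK] at this
      simpa [survival, hx] using this
    | succ n ih =>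
      rw [survival_succ_of_mem hx, survival_succ_of_mem hx]
      refine mulVec_mono hK (fun y => ?_) x
      by_cases hy : y ∈ B
      · exact ih y hy
      · rw [survival_of_notMem hy, survival_of_notMem hy]
  · rw [survival_of_notMem hx, survival_of_notMem hx]

lemma survival_antitone (hK : K ∈ rowStochastic ℝ E) (x : E) :
    Antitone fun n => survival K B n x :=
  antitone_nat_of_succ_le fun n => survival_succ_le hK n x

lemma survival_le_one (hK : K ∈ rowStochastic ℝ E) (n : ℕ) (x : E) : survival K B n x ≤ 1 :=
  (survival_antitone hK x (Nat.zero_le n)).trans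
    (Set.indicator_apply_le' (fun _ => le_rfl) fun _ => zero_le_one)

lemma survival_le_pow_mulVec (hK : K ∈ rowStochastic ℝ E) (n : ℕ) (x : E) :
    survival K B n x ≤ ((K ^ n) *ᵥ B.indicator 1) x := by
  induction n generalizing x with
  | zero => simp [survival]
  | succ n ih =>
    rw [pow_succ', ← mulVec_mulVec]
    have h1 := mulVec_mono hK ih x
    by_cases hx : x ∈ B
    · rwa [survival_succ_of_mem hx]
    · rw [survival_of_notMem hx]
      exact (nonneg_mulVec_of_mem_rowStochastic hK (survival_nonneg hK n) x).trans h1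

omit [DecidableEq E] in
lemma mulVec_sum_survival {x : E} (hx : x ∈ B) (n : ℕ) :
    (K *ᵥ ∑ j ∈ range n, survival K B j) x = ∑ j ∈ range n, survival K B (j + 1) x := by
  rw [mulVec_sum, Finset.sum_apply]
  exact sum_congr rfl fun j _ => (survival_succ_of_mem hx j).symm

end survival

/-- Survival requires being in `B` at time `T`, which has probability at most 1/4 + 1/4. Shifting
the indicator by 1/2 halves its sup norm and gives the second 1/4. -/
lemma survival_le_half {K : Matrix E E ℝ} {π : E → ℝ} (h : IsReversibleWrt K π) {T : ℕ}
    (hd : worstDist K π T ≤ 1 / 4) {B : Set E} (hB : weightedInner π (B.indicator 1) 1 ≤ 1 / 4)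
    (x : E) : survival K B T x ≤ 1 / 2 := by
  refine (survival_le_pow_mulVec h.stochastic T x).trans ?_
  have h1 := abs_pow_mulVec_sub_le (f := B.indicator (1 : E → ℝ) - fun _ => 1 / 2) (c := 1 / 2) hd
    (fun y => ?_) (by norm_num) x
  · have h2 : ∑ y, π y * (B.indicator (1 : E → ℝ) - fun _ : E => (1 / 2 : ℝ)) y =
        weightedInner π (B.indicator 1) 1 - 1 / 2 := by
      simp only [weightedInner, Pi.sub_apply, mul_sub, sum_sub_distrib, Pi.one_apply, mul_one,
        ← sum_mul, h.sum_eq_one, one_mul]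
    rw [h2, mulVec_sub, mulVec_const (h.pow T).stochastic] at h1
    have := (abs_le.1 h1).2
    simp only [Pi.sub_apply] at this
    linarith
  · by_cases hy : y ∈ B <;> norm_num [hy, abs_le]

/-- A set of small stationary measure is left by the time-changed chain within a time comparable
with the mixing time of the original chain. -/
lemma IsTimeChange.mul_survival_le {Q R : Matrix E E ℝ} {μ ν g : E → ℝ} {C c : ℝ}
    (h : IsTimeChange Q R μ ν g C c) {T : ℕ}
    (hd : worstDist Q μ T ≤ 1 / 4) {B : Set E} (hB : weightedInner μ (B.indicator 1) 1 ≤ 1 / 4)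
    (n : ℕ) (x : E) : n * survival R B n x ≤ 2 * C * T := by
  have hQ := h.left.stochastic
  have hR := h.right.stochastic
  have hC := h.one_le
  -- `u x` is the expected exit time of `Q` from `B`, truncated at `T`; its drift telescopes to `1 -
  -- survival Q B T`.
  let u : E → ℝ := ∑ j ∈ range T, survival Q B j
  have hu : ∀ x, u x = ∑ j ∈ range T, survival Q B j x := fun x => Finset.sum_apply _ _ _
  have hu0 : ∀ x, 0 ≤ u x := fun x => by
    rw [hu]; exact sum_nonneg fun j _ => survival_nonneg hQ j x
  have huT : ∀ x, u x ≤ T := fun x => by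
    rw [hu]
    refine (sum_le_sum fun j _ => survival_le_one hQ j x).trans ?_
    simp
  have hdrift : ∀ x ∈ B, 1 ≤ 2 * C * (u - R *ᵥ u) x := fun x hx => by
    have h1 : (u - Q *ᵥ u) x = 1 - survival Q B T x := by
      rw [Pi.sub_apply, mulVec_sum_survival hx, hu, ← sum_sub_distrib, sum_range_sub']
      simp [survival, hx]
    have h2 := survival_le_half h.left hd hB x
    rw [h.sub_mulVec, h1]
    have := h.le_rate x
    nlinarith
  -- Comparison principle: `2 * C * u` is a nonnegative supersolution of the exit-time equation of
  -- `R`, so it dominates the truncated expected exit time.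
  have hsum : ∀ n x, ∑ j ∈ range n, survival R B j x ≤ 2 * C * u x := by
    intro n
    induction n with
    | zero => intro x; simpa using mul_nonneg (by linarith) (hu0 x)
    | succ n ih =>
      intro x
      by_cases hx : x ∈ B
      · rw [sum_range_succ', ← mulVec_sum_survival hx]
        have h3 := mulVec_mono (f := ∑ j ∈ range n, survival R B j) (g := (2 * C) • u) hR
          (fun y => by simpa using ih y) x
        have h4 := hdrift x hx
        rw [mulVec_smul, Pi.smul_apply, smul_eq_mul] at h3
        rw [Pi.sub_apply] at h4
        have h5 : survival R B 0 x = 1 := by simp [survival, hx]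
        linarith
      · rw [sum_eq_zero fun j _ => survival_of_notMem hx j]
        exact mul_nonneg (by linarith) (hu0 x)
  -- Markov's inequality, by monotonicity of survival in time.
  calc n * survival R B n x = ∑ j ∈ range n, survival R B n x := by simp
    _ ≤ ∑ j ∈ range n, survival R B j x :=
        sum_le_sum fun j hj => survival_antitone hR x (mem_range.1 hj).le
    _ ≤ 2 * C * u x := hsum n x
    _ ≤ 2 * C * T := mul_le_mul_of_nonneg_left (huT x) (by linarith)

/-! ### Control of a sequence over a time window -/

/-- A quadratic functional dominating `a j ^ 2` for all `j ≤ n`. -/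
def windowBound (n : ℕ) (a : ℕ → ℝ) : ℝ :=
  a 0 ^ 2 + ∑ k ∈ range n,
    ((n / 2 : ℝ) * (a k - a (k + 1)) ^ 2 + (1 / n : ℝ) * (a k ^ 2 + a (k + 1) ^ 2))

lemma windowBound_nonneg (n : ℕ) (a : ℕ → ℝ) : 0 ≤ windowBound n a := by
  unfold windowBound; positivity

/-- A discrete Sobolev inequality: telescope `a j ^ 2`, factor each increment as a difference times
a sum, and apply AM-GM with weight `n`. -/
lemma sq_le_windowBound (a : ℕ → ℝ) {n j : ℕ} (hj : j ≤ n) : a j ^ 2 ≤ windowBound n a := by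
  rcases Nat.eq_zero_or_pos n with rfl | hn
  · obtain rfl : j = 0 := by omega
    simp [windowBound]
  have hn' : (0 : ℝ) < n := by exact_mod_cast hn
  have hterm : ∀ k, a (k + 1) ^ 2 - a k ^ 2 ≤
      (n / 2 : ℝ) * (a k - a (k + 1)) ^ 2 + (1 / n : ℝ) * (a k ^ 2 + a (k + 1) ^ 2) := by
    intro k
    have h1 : 0 ≤ (1 / (2 * n) : ℝ) * (n * (a k - a (k + 1)) + (a k + a (k + 1))) ^ 2 := by
      positivity
    have h2 : (1 / (2 * n) : ℝ) * (n * (a k - a (k + 1)) + (a k + a (k + 1))) ^ 2 =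
        (n / 2 : ℝ) * (a k - a (k + 1)) ^ 2 + (a k ^ 2 - a (k + 1) ^ 2) +
          (1 / n : ℝ) * ((a k + a (k + 1)) ^ 2 / 2) := by
      field_simp; ring
    have h3 : (1 / n : ℝ) * ((a k + a (k + 1)) ^ 2 / 2) ≤ (1 / n : ℝ) * (a k ^ 2 + a (k + 1) ^ 2) :=
      mul_le_mul_of_nonneg_left (by nlinarith [sq_nonneg (a k - a (k + 1))]) (by positivity)
    linarith
  have h1 : a j ^ 2 = a 0 ^ 2 + ∑ k ∈ range j, (a (k + 1) ^ 2 - a k ^ 2) := by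
    rw [sum_range_sub (fun k => a k ^ 2)]; ring
  rw [h1, windowBound]
  gcongr
  refine (sum_le_sum fun k _ => hterm k).trans ?_
  exact sum_le_sum_of_subset_of_nonneg (range_mono hj) fun k _ _ => by positivity

/-- The squared increments form a geometric sum, in which `1 + l ≥ 2c` controls the denominator. The
weight `s` is absorbed by `s * |l| ^ s * (1 - |l|) ≤ 1`, leaving one factor `|l| ^ s`. -/
lemma windowBound_pow_le {c l : ℝ} (hc : 0 < c) (hc1 : c < 1) (hl : 2 * c ≤ 1 + l) (hl1 : l ≤ 1)
    {s : ℕ} (hs : 1 ≤ s) : windowBound s (fun k => l ^ (s + k)) ≤ 4 / c ^ 2 * |l| ^ s := by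
  have hs' : (0 : ℝ) < s := by exact_mod_cast hs
  have habs : |l| ≤ 1 := abs_le.2 ⟨by linarith, hl1⟩
  have hsq : ∀ k, (l ^ (s + k)) ^ 2 ≤ |l| ^ s := fun k => by
    rw [← pow_mul, ← Even.pow_abs (n := (s + k) * 2) (by simp)]
    exact pow_le_pow_of_le_one (abs_nonneg _) habs (by omega)
  have hA : ∑ k ∈ range s, (1 / s : ℝ) * ((l ^ (s + k)) ^ 2 + (l ^ (s + (k + 1))) ^ 2) ≤
      2 * |l| ^ s := by
    calc _ ≤ ∑ k ∈ range s, (1 / s : ℝ) * (|l| ^ s + |l| ^ s) := by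
          refine sum_le_sum fun k _ => mul_le_mul_of_nonneg_left ?_ (by positivity)
          exact add_le_add (hsq k) (hsq (k + 1))
      _ = 2 * |l| ^ s := by simp; field_simp; ring
  have hgeom : s * (|l| ^ s * (1 - |l|)) ≤ 1 := by
    calc s * (|l| ^ s * (1 - |l|)) = ∑ k ∈ range s, |l| ^ s * (1 - |l|) := by simp
      _ ≤ ∑ k ∈ range s, |l| ^ k * (1 - |l|) :=
          sum_le_sum fun k hk => mul_le_mul_of_nonneg_right
            (pow_le_pow_of_le_one (abs_nonneg _) habs (mem_range.1 hk).le) (by linarith)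
      _ = 1 - |l| ^ s := by rw [← sum_mul, geom_sum_mul_neg]
      _ ≤ 1 := by linarith [pow_nonneg (abs_nonneg l) s]
  -- For negative `l`, `1 - |l| = 1 + l ≥ 2c` while `1 - l ≤ 2`.
  have hgap : 1 - l ≤ (1 - |l|) / c := by
    rw [le_div_iff₀ hc]
    rcases abs_cases l with ⟨h, _⟩ | ⟨h, _⟩ <;> rw [h] <;> nlinarith
  have hD : ∑ k ∈ range s, (l ^ (s + k) - l ^ (s + (k + 1))) ^ 2 ≤
      |l| ^ s * (|l| ^ s * (1 - |l|)) / (2 * c ^ 2) := by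
    have h1 : ∑ k ∈ range s, (l ^ (s + k) - l ^ (s + (k + 1))) ^ 2 =
        (l ^ s) ^ 2 * (1 - l) ^ 2 * ∑ k ∈ range s, (l ^ 2) ^ k := by
      rw [mul_sum]
      exact sum_congr rfl fun k _ => by ring
    have h2 : (1 - l) * ((1 + l) * ∑ k ∈ range s, (l ^ 2) ^ k) ≤ 1 := by
      calc (1 - l) * ((1 + l) * ∑ k ∈ range s, (l ^ 2) ^ k)
          = (∑ k ∈ range s, (l ^ 2) ^ k) * (1 - l ^ 2) := by ring
        _ = 1 - (l ^ 2) ^ s := geom_sum_mul_neg _ _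
        _ ≤ 1 := by linarith [pow_nonneg (sq_nonneg l) s]
    have h3 : (l ^ s) ^ 2 = |l| ^ s * |l| ^ s := by rw [← abs_pow, abs_mul_abs_self, sq]
    have h4 : 0 ≤ ∑ k ∈ range s, (l ^ (s + k) - l ^ (s + (k + 1))) ^ 2 := by positivity
    rw [le_div_iff₀ (by positivity)]
    calc (∑ k ∈ range s, (l ^ (s + k) - l ^ (s + (k + 1))) ^ 2) * (2 * c ^ 2)
        = c * ((2 * c) * ∑ k ∈ range s, (l ^ (s + k) - l ^ (s + (k + 1))) ^ 2) := by ring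
      _ ≤ c * ((1 + l) * ∑ k ∈ range s, (l ^ (s + k) - l ^ (s + (k + 1))) ^ 2) := by gcongr
      _ = c * ((l ^ s) ^ 2 * (1 - l) *
            ((1 - l) * ((1 + l) * ∑ k ∈ range s, (l ^ 2) ^ k))) := by rw [h1]; ring
      _ ≤ c * ((l ^ s) ^ 2 * (1 - l) * 1) := by
          have : 0 ≤ 1 - l := by linarith
          gcongr
      _ ≤ c * ((l ^ s) ^ 2 * ((1 - |l|) / c)) := by rw [mul_one]; gcongr
      _ = |l| ^ s * (|l| ^ s * (1 - |l|)) := by rw [h3]; field_simp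
  have hD' : (s / 2 : ℝ) * ∑ k ∈ range s, (l ^ (s + k) - l ^ (s + (k + 1))) ^ 2 ≤
      1 / (4 * c ^ 2) * |l| ^ s := by
    calc _ ≤ (s / 2 : ℝ) * (|l| ^ s * (|l| ^ s * (1 - |l|)) / (2 * c ^ 2)) := by gcongr
      _ = 1 / (4 * c ^ 2) * |l| ^ s * (s * (|l| ^ s * (1 - |l|))) := by field_simp; ring
      _ ≤ 1 / (4 * c ^ 2) * |l| ^ s * 1 := by gcongr
      _ = _ := mul_one _
  have h0 := hsq 0
  have hfin : 3 + 1 / (4 * c ^ 2) ≤ 4 / c ^ 2 := by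
    have : c ^ 2 < 1 := by nlinarith
    have h1 : 1 ≤ 1 / c ^ 2 := by rw [le_div_iff₀ (by positivity)]; linarith
    have h2 : 1 / (4 * c ^ 2) = 1 / 4 * (1 / c ^ 2) := by ring
    have h3 : 4 / c ^ 2 = 4 * (1 / c ^ 2) := by ring
    linarith
  have := mul_le_mul_of_nonneg_right hfin (pow_nonneg (abs_nonneg l) s)
  simp only [windowBound, sum_add_distrib, ← mul_sum] at hA ⊢
  linarith

omit [DecidableEq E] in
lemma sum_mul_sq_eq {π : E → ℝ} {φ : E → E → ℝ}
    (hP : ∀ f g, weightedInner π f g = ∑ i, weightedInner π f (φ i) * weightedInner π g (φ i))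
    (g : E → ℝ) {q : E → ℝ} {f : E → ℝ}
    (hg : ∀ i, weightedInner π g (φ i) = q i * weightedInner π f (φ i)) :
    ∑ x, π x * g x ^ 2 = ∑ i, weightedInner π f (φ i) ^ 2 * q i ^ 2 := by
  have : ∑ x, π x * g x ^ 2 = weightedInner π g g := sum_congr rfl fun x _ => by ring
  rw [this, hP]
  exact sum_congr rfl fun i _ => by rw [hg]; ring

namespace IsReversibleWrt

variable {K : Matrix E E ℝ} {π : E → ℝ}

lemma weightedInner_self_le_one (h : IsReversibleWrt K π) {f : E → ℝ} (hf : ∀ x, |f x| ≤ 1) :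
    weightedInner π f f ≤ 1 := by
  rw [← h.sum_eq_one]
  refine sum_le_sum fun x _ => ?_
  have h1 : f x * f x ≤ 1 := by rw [← abs_mul_abs_self]; nlinarith [hf x, abs_nonneg (f x)]
  have := mul_le_mul_of_nonneg_left h1 (h.pos x).le
  linarith

/-- `windowBound` is a combination of squares of linear functionals of the sequence, so Parseval
applies to each term. -/
lemma sum_windowBound (h : IsReversibleWrt K π) {l : E → ℝ} {φ : E → E → ℝ}
    (hφ : ∀ i, K *ᵥ φ i = l i • φ i)
    (hP : ∀ f g, weightedInner π f g = ∑ i, weightedInner π f (φ i) * weightedInner π g (φ i))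
    (f : E → ℝ) (s n : ℕ) :
    ∑ x, π x * windowBound n (fun k => ((K ^ (s + k)) *ᵥ f) x) =
      ∑ i, weightedInner π f (φ i) ^ 2 * windowBound n (fun k => l i ^ (s + k)) := by
  have h1 : ∀ t, ∑ x, π x * ((K ^ t) *ᵥ f) x ^ 2 =
      ∑ i, weightedInner π f (φ i) ^ 2 * (l i ^ t) ^ 2 := fun t =>
    sum_mul_sq_eq hP _ fun i => h.weightedInner_pow_eigenfunction (hφ i) f t
  have h2 : ∀ t t', ∑ x, π x * (((K ^ t) *ᵥ f) x - ((K ^ t') *ᵥ f) x) ^ 2 =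
      ∑ i, weightedInner π f (φ i) ^ 2 * (l i ^ t - l i ^ t') ^ 2 := fun t t' =>
    sum_mul_sq_eq hP ((K ^ t) *ᵥ f - (K ^ t') *ᵥ f) fun i => by
      rw [weightedInner_sub_left, h.weightedInner_pow_eigenfunction (hφ i) f t,
        h.weightedInner_pow_eigenfunction (hφ i) f t', sub_mul]
  have hswap : ∀ (w : E → ℝ) (F : E → ℕ → ℝ),
      ∑ x, w x * ∑ k ∈ range n, F x k = ∑ k ∈ range n, ∑ x, w x * F x k := fun w F => by
    simp only [mul_sum]
    exact sum_comm
  simp only [windowBound, mul_add, sum_add_distrib, mul_sum, mul_left_comm (π _),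
    mul_left_comm (weightedInner _ _ _ ^ 2)]
  rw [h1]
  simp only [← mul_sum]
  simp only [hswap, h1, h2]

end IsReversibleWrt

/-! ### From `L²` decay to pointwise decay -/

/-- Outside the exceptional set `B` the function `K ^ (s + j) f` is small for `j ≤ n`, hence
everywhere it is bounded by the probability not to leave `B`. -/
lemma abs_pow_add_mulVec_le_survival {K : Matrix E E ℝ} (hK : K ∈ rowStochastic ℝ E) {f : E → ℝ}
    (hf : ∀ x, |f x| ≤ 1) {B : Set E} {s n : ℕ} {ε : ℝ} (hε : 0 ≤ ε)
    (hB : ∀ x ∉ B, ∀ j ≤ n, |((K ^ (s + j)) *ᵥ f) x| ≤ ε) {j : ℕ} (hj : j ≤ n) (x : E) :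
    |((K ^ (s + j)) *ᵥ f) x| ≤ ε + survival K B j x := by
  induction j generalizing x with
  | zero =>
    by_cases hx : x ∈ B
    · have h1 := abs_mulVec_le (pow_mem hK (s + 0)) hf x
      simp only [survival, Set.indicator_of_mem hx, Pi.one_apply]
      linarith
    · rw [survival_of_notMem hx]
      linarith [hB x hx 0 hj]
  | succ j ih =>
    by_cases hx : x ∈ B
    -- First-step analysis: inside `B`, apply `K` to the bound at time `j`.
    · rw [survival_succ_of_mem hx, ← add_assoc, pow_succ', ← mulVec_mulVec]
      have hi := ih (by omega)
      have h1 : ε + (K *ᵥ survival K B j) x = (K *ᵥ ((fun _ => ε) + survival K B j)) x := by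
        rw [mulVec_add, mulVec_const hK, Pi.add_apply]
      rw [h1, abs_le, ← Pi.neg_apply, ← mulVec_neg]
      exact ⟨mulVec_mono hK (fun y => (abs_le.1 (hi y)).1) x,
        mulVec_mono hK (fun y => (abs_le.1 (hi y)).2) x⟩
    · rw [survival_of_notMem hx, add_zero]
      exact hB x hx _ hj

lemma one_sub_div_pow_le {κ : ℝ} {m T : ℕ} (hκ : 0 < κ) (hm : 1 ≤ m) (hT : 1 ≤ T)
    (h1 : κ / T ≤ 1) : (1 - κ / T) ^ (m * T) ≤ 1 / (κ * m) := by
  have hT' : (0 : ℝ) < T := by exact_mod_cast hT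
  have hm' : (0 : ℝ) < m := by exact_mod_cast hm
  calc (1 - κ / T) ^ (m * T) ≤ Real.exp (-(κ / T)) ^ (m * T) :=
        pow_le_pow_left₀ (by linarith) (Real.one_sub_le_exp_neg _) _
    _ = Real.exp (-(κ * m)) := by
        rw [← Real.exp_nat_mul]; congr 1; push_cast; field_simp
    _ = 1 / Real.exp (κ * m) := by rw [Real.exp_neg, one_div]
    _ ≤ 1 / (κ * m) := by
        refine one_div_le_one_div_of_le (by positivity) ?_
        linarith [Real.add_one_le_exp (κ * m)]

namespace IsTimeChange

variable {Q R : Matrix E E ℝ} {μ ν g : E → ℝ} {C c : ℝ}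

/-- Constant modes vanish because `f` has mean zero. On the others, the gap of order `1 / T` gives
`|l| ^ (m * T)` of order `1 / m`, and the total spectral mass is at most 1. -/
lemma sum_windowBound_le [Nonempty E] (h : IsTimeChange Q R μ ν g C c) {T m : ℕ} (hT : 1 ≤ T)
    (hm : 1 ≤ m) (hd : worstDist Q μ T ≤ 1 / 4) {f : E → ℝ} (hf : ∀ x, |f x| ≤ 1)
    (hf0 : weightedInner ν f 1 = 0) :
    ∑ x, ν x * windowBound (m * T) (fun k => ((R ^ (m * T + k)) *ᵥ f) x) ≤
      8 * C ^ 3 / (c ^ 3 * m) := by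
  obtain ⟨l, φ, hφ, hP⟩ := h.right.exists_eigenfunctions
  have hC := h.one_le
  have hc := h.lazy_pos
  have hs : 1 ≤ m * T := Nat.mul_pos hm hT
  have hm' : (0 : ℝ) < m := by exact_mod_cast hm
  rw [h.right.sum_windowBound hφ hP]
  calc _ ≤ ∑ i, weightedInner ν f (φ i) * weightedInner ν f (φ i) * (8 * C ^ 3 / (c ^ 3 * m)) := by
        refine sum_le_sum fun i _ => ?_
        rcases h.eq_const_or_gap hT hd (hφ i) with h0 | ⟨h1, h2, h3⟩
        · have : weightedInner ν f (φ i) = 0 := by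
            rw [sub_eq_zero.1 h0,
              show (fun _ : E => weightedInner ν (φ i) 1) = weightedInner ν (φ i) 1 • (1 : E → ℝ) by
                ext; simp, weightedInner_smul_right, hf0, mul_zero]
          simp [this]
        · rw [← sq]
          refine mul_le_mul_of_nonneg_left ?_ (sq_nonneg _)
          refine (windowBound_pow_le hc h.lazy_lt h1 h2 hs).trans ?_
          have h4 : c / (2 * C ^ 3) / T ≤ 1 := by linarith [abs_nonneg (l i)]
          have h5 := (pow_le_pow_left₀ (abs_nonneg _) h3 (m * T)).trans
            (one_sub_div_pow_le (by positivity) hm hT h4)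
          calc 4 / c ^ 2 * |l i| ^ (m * T) ≤ 4 / c ^ 2 * (1 / (c / (2 * C ^ 3) * m)) := by gcongr
            _ = 8 * C ^ 3 / (c ^ 3 * m) := by field_simp; ring
    _ = weightedInner ν f f * (8 * C ^ 3 / (c ^ 3 * m)) := by rw [hP f f, sum_mul]
    _ ≤ 1 * (8 * C ^ 3 / (c ^ 3 * m)) := by
        gcongr
        exact h.right.weightedInner_self_le_one hf
    _ = _ := one_mul _

/-- If `Q` has mixed by time `T ≥ 1`, then its time change `R` has mixed after a bounded multiple
of `T`. -/
theorem worstDist_le [Nonempty E] (h : IsTimeChange Q R μ ν g C c) {T m : ℕ} (hT : 1 ≤ T)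
    (hm : 2048 * C ^ 4 / c ^ 3 ≤ m) (hd : worstDist Q μ T ≤ 1 / 4) :
    worstDist R ν (2 * m * T) ≤ 1 / 4 := by
  have hC := h.one_le
  have hc := h.lazy_pos
  have hc3 : c ^ 3 ≤ 1 := pow_le_one₀ hc.le h.lazy_lt.le
  -- 2048 = 4 · 64 · 8: 8 from the window estimate, 64 from Chebyshev at level 1/8, and 4 from the
  -- target measure `1 / (4 * C)`.
  have hm4 : 2048 * C ^ 4 ≤ m * c ^ 3 := (div_le_iff₀ (by positivity)).1 hm
  have hC4 : C ≤ C ^ 4 := le_self_pow₀ hC (by norm_num)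
  have hm2 : 2048 * C ≤ m := by
    have : (m : ℝ) * c ^ 3 ≤ m * 1 := by gcongr
    linarith
  have hm0 : (0 : ℝ) < m := by linarith
  have hm1 : 1 ≤ m := by exact_mod_cast hm0
  have hT0 : (0 : ℝ) < T := by exact_mod_cast hT
  refine worstDist_le_of_forall h.right fun f hf hf0 x => ?_
  let B : Set E := {x | ∃ j ≤ m * T, 1 / 8 < |((R ^ (m * T + j)) *ᵥ f) x|}
  have hBν : weightedInner ν (B.indicator 1) 1 ≤ 1 / (4 * C) := by
    calc weightedInner ν (B.indicator 1) 1
        ≤ 64 * ∑ x, ν x * windowBound (m * T) (fun k => ((R ^ (m * T + k)) *ᵥ f) x) := by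
          rw [weightedInner, mul_sum]
          refine sum_le_sum fun x _ => ?_
          have hν := h.right.pos x
          have hw := windowBound_nonneg (m * T) (fun k => ((R ^ (m * T + k)) *ᵥ f) x)
          by_cases hx : x ∈ B
          · obtain ⟨j, hj, hjx⟩ := hx
            have h1 := sq_le_windowBound (fun k => ((R ^ (m * T + k)) *ᵥ f) x) hj
            have h2 : 1 / 64 ≤ ((R ^ (m * T + j)) *ᵥ f) x ^ 2 := by
              rw [← sq_abs]; nlinarith
            have h3 := mul_le_mul_of_nonneg_left (h2.trans h1) hν.le
            rw [Set.indicator_of_mem (show x ∈ B from ⟨j, hj, hjx⟩)]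
            simp only [Pi.one_apply]
            linarith
          · rw [Set.indicator_of_notMem hx]
            have := mul_nonneg hν.le hw
            simpa using this
      _ ≤ 64 * (8 * C ^ 3 / (c ^ 3 * m)) := by
          gcongr
          exact h.sum_windowBound_le hT hm1 hd hf hf0
      _ ≤ 1 / (4 * C) := by
          rw [mul_div_assoc', div_le_div_iff₀ (by positivity) (by positivity)]
          linarith
  have hBμ : weightedInner μ (B.indicator 1) 1 ≤ 1 / 4 := by
    calc weightedInner μ (B.indicator 1) 1 ≤ C * weightedInner ν (B.indicator 1) 1 := by
          simp only [weightedInner, mul_sum]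
          refine sum_le_sum fun x _ => ?_
          have : 0 ≤ B.indicator (1 : E → ℝ) x := Set.indicator_nonneg (fun _ _ => zero_le_one) x
          have := mul_le_mul_of_nonneg_right (h.left_le x) this
          simp only [Pi.one_apply]
          linarith
      _ ≤ C * (1 / (4 * C)) := by gcongr
      _ = 1 / 4 := by field_simp
  have h1 := abs_pow_add_mulVec_le_survival h.right.stochastic hf (B := B) (s := m * T)
    (n := m * T) (ε := 1 / 8) (by norm_num)
    (fun y hy j hj => by
      by_contra hcon
      exact hy ⟨j, hj, not_le.1 hcon⟩) le_rfl x
  have h2 := h.mul_survival_le hd hBμ (m * T) x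
  have h3 : survival R B (m * T) x ≤ 1 / 8 := by
    have h4 : (T : ℝ) * (m * survival R B (m * T) x) ≤ T * (2 * C) := by
      push_cast at h2; linarith
    have h5 := le_of_mul_le_mul_left h4 hT0
    by_contra hcon
    push Not at hcon
    nlinarith
  rw [show 2 * m * T = m * T + m * T by ring]
  linarith

end IsTimeChange

/-! ### Irreducible chains -/

/-- Maximum principle: at a maximum, the average over any power of `P` forces equality at every
point that the power reaches. -/
lemma eq_of_mulVec_eq_self [Nonempty E] {P : Matrix E E ℝ} (hP : P ∈ rowStochastic ℝ E)
    (hirr : P.IsIrreducible) {f : E → ℝ} (hf : P *ᵥ f = f) (x y : E) : f x = f y := by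
  obtain ⟨z, hz⟩ := Finite.exists_max f
  suffices ∀ w, f w = f z by rw [this x, this y]
  intro w
  obtain ⟨k, -, hk⟩ := (isIrreducible_iff_exists_pow_pos hirr.nonneg).1 hirr z w
  have h1 := pow_mulVec_eigenvector (l := 1) (hf.trans (one_smul ℝ f).symm) k
  have hPk := pow_mem hP k
  have h2 : ∑ v, (P ^ k) z v * (f z - f v) = 0 := by
    have h3 := congrFun h1 z
    simp only [mulVec, dotProduct, one_pow, one_smul] at h3
    simp only [mul_sub, sum_sub_distrib, ← sum_mul, sum_row_of_mem_rowStochastic hPk, h3]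
    ring
  have h4 := (sum_eq_zero_iff_of_nonneg fun v _ =>
    mul_nonneg (hPk.1 z v) (sub_nonneg.2 (hz v))).1 h2 w (mem_univ _)
  rcases mul_eq_zero.1 h4 with h | h
  · exact absurd h hk.ne'
  · linarith

lemma IsStationary.pos {P : Matrix E E ℝ} (hirr : P.IsIrreducible) {π : E → ℝ}
    (h : IsStationary P π) (x : E) : 0 < π x := by
  obtain ⟨y, -, hy⟩ : ∃ y ∈ (univ : Finset E), 0 < π y := by
    by_contra! hcon
    have := sum_nonpos hcon
    rw [h.sum_eq_one] at this
    linarith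
  obtain ⟨k, -, hk⟩ := (isIrreducible_iff_exists_pow_pos hirr.nonneg).1 hirr y x
  have h1 : ∀ k, π ᵥ* P ^ k = π := fun k => by
    induction k with
    | zero => simp
    | succ k ih => rw [pow_succ, ← vecMul_vecMul, ih, h.vecMul_eq]
  have hnn : ∀ (k : ℕ) z w, 0 ≤ (P ^ k) z w := fun k => by
    induction k with
    | zero => intro z w; rw [pow_zero, one_apply]; split_ifs <;> norm_num
    | succ k ih =>
      intro z w
      rw [pow_succ, mul_apply]
      exact sum_nonneg fun v _ => mul_nonneg (ih z v) (hirr.nonneg v w)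
  rw [← congrFun (h1 k) x]
  exact sum_pos' (fun z _ => mul_nonneg (h.nonneg z) (hnn k z x)) ⟨y, mem_univ _, mul_pos hy hk⟩

/-- If all harmonic functions are constant, the stationary distribution is unique. -/
lemma IsReversibleWrt.stationaryDistribution_eq [Nonempty E] {K : Matrix E E ℝ} {π : E → ℝ}
    (h : IsReversibleWrt K π) (hK : ∀ f, K *ᵥ f = f → ∀ x y, f x = f y) :
    stationaryDistribution K = π := by
  have hν : IsStationary K (stationaryDistribution K) := Classical.epsilon_spec ⟨π, h.isStationary⟩
  set ν := stationaryDistribution K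
  obtain ⟨z⟩ := ‹Nonempty E›
  -- By reversibility, the density of a stationary measure with respect to `π` is harmonic.
  have hharm : K *ᵥ (fun x => ν x / π x) = fun x => ν x / π x := by
    ext x
    rw [eq_div_iff (h.pos x).ne', ← congrFun hν.vecMul_eq x]
    simp only [mulVec, vecMul, dotProduct, sum_mul]
    refine sum_congr rfl fun y _ => ?_
    have := (h.pos y).ne'
    field_simp
    linear_combination (ν y) * h.balance x y
  have hconst : ∀ x, ν x = ν z / π z * π x := fun x => by
    rw [← hK _ hharm x z, div_mul_cancel₀ _ (h.pos x).ne']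
  have h1 : ν z / π z = 1 := by
    have := hν.sum_eq_one
    rw [sum_congr rfl fun x _ => hconst x, ← mul_sum, h.sum_eq_one, mul_one] at this
    exact this
  ext x
  rw [hconst, h1, one_mul]

/-- Holding excludes the eigenvalue -1, and the eigenvalue 1 has only constant eigenfunctions,
orthogonal to mean-zero functions. Hence `L²` norms of mean-zero functions decay, and positivity of
`π` makes the decay pointwise. -/
lemma IsReversibleWrt.exists_worstDist_le [Nonempty E] {K : Matrix E E ℝ} {π : E → ℝ}
    (h : IsReversibleWrt K π) {c : ℝ} (hc : 0 < c) (hlazy : ∀ x, c ≤ K x x)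
    (hK : ∀ f, K *ᵥ f = f → ∀ x y, f x = f y) {ε : ℝ} (hε : 0 < ε) :
    ∃ t, worstDist K π t ≤ ε := by
  obtain ⟨l, φ, hφ, hP⟩ := h.exists_eigenfunctions
  have hzero : ∀ f, weightedInner π f 1 = 0 → ∀ x,
      Tendsto (fun t : ℕ => ((K ^ t) *ᵥ f) x) atTop (𝓝 0) := by
    intro f hf x
    have hcoef : ∀ i, Tendsto (fun t : ℕ => l i ^ t * weightedInner π f (φ i)) atTop (𝓝 0) := by
      intro i
      by_cases h0 : φ i = 0
      · simp [h0, weightedInner]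
      obtain ⟨h1, h2⟩ := eigenvalue_mem_Icc h.stochastic hlazy (hφ i) h0
      rcases h2.lt_or_eq with h2 | h2
      · have := tendsto_pow_atTop_nhds_zero_of_abs_lt_one (abs_lt.2 ⟨by linarith, h2⟩)
        simpa using this.mul_const (weightedInner π f (φ i))
      · have h3 := hK (φ i) (by rw [hφ, h2, one_smul])
        have h4 : φ i = φ i x • (1 : E → ℝ) := by ext y; simpa using h3 y x
        rw [h4, weightedInner_smul_right, hf]
        simp
    have hsum : Tendsto (fun t : ℕ => weightedInner π ((K ^ t) *ᵥ f) ((K ^ t) *ᵥ f)) atTop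
        (𝓝 0) := by
      have hcongr : ∀ t : ℕ, weightedInner π ((K ^ t) *ᵥ f) ((K ^ t) *ᵥ f) =
          ∑ i, l i ^ t * weightedInner π f (φ i) * (l i ^ t * weightedInner π f (φ i)) :=
        fun t => by
          rw [hP]
          exact sum_congr rfl fun i _ => by rw [h.weightedInner_pow_eigenfunction (hφ i)]
      simp only [hcongr]
      simpa using tendsto_finsetSum univ fun i _ => (hcoef i).mul (hcoef i)
    have hsq : Tendsto (fun t : ℕ => ((K ^ t) *ᵥ f) x ^ 2) atTop (𝓝 0) := by
      refine squeeze_zero (fun t => sq_nonneg _) (fun t => ?_)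
        (by simpa using hsum.const_mul (1 / π x))
      rw [← div_eq_inv_mul, le_div_iff₀ (h.pos x)]
      refine le_trans (le_of_eq (by ring)) (single_le_sum (f := fun x =>
        π x * ((K ^ t) *ᵥ f) x * ((K ^ t) *ᵥ f) x) (fun y _ => ?_) (mem_univ x))
      rw [mul_assoc]
      exact mul_nonneg (h.pos y).le (mul_self_nonneg _)
    have := hsq.sqrt
    simp only [Real.sqrt_sq_eq_abs, Real.sqrt_zero] at this
    exact (tendsto_zero_iff_abs_tendsto_zero _).2 this
  have htv : ∀ x, Tendsto (fun t : ℕ => tvDist ((K ^ t) x) π) atTop (𝓝 0) := by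
    intro x
    have h1 : ∀ y, Tendsto (fun t : ℕ => |(K ^ t) x y - π y|) atTop (𝓝 0) := by
      intro y
      have h2 := hzero (Pi.single y 1 - fun _ => π y)
        (by
          rw [weightedInner_sub_left, h.weightedInner_const_one]
          simp [weightedInner, Pi.single_apply]) x
      refine ((tendsto_zero_iff_abs_tendsto_zero _).1 h2).congr fun t => ?_
      simp [Function.comp, mulVec_sub, mulVec_const (h.pow t).stochastic]
    simpa only [tvDist, sum_const_zero, mul_zero] using
      (tendsto_finsetSum univ fun y _ => h1 y).const_mul (1 / 2 : ℝ)
  have hev : ∀ᶠ t : ℕ in atTop, ∀ x, tvDist ((K ^ t) x) π ≤ ε :=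
    eventually_all.2 fun x => (htv x).eventually (ge_mem_nhds hε)
  obtain ⟨t, ht⟩ := hev.exists
  exact ⟨t, ciSup_le ht⟩

/-! ### Holding chains -/

section holding

variable {P : Matrix E E ℝ} {a b : E → ℝ}

lemma lazyVersion_eq_holdingChain {E : Type*} [DecidableEq E] (P : Matrix E E ℝ) :
    lazyVersion P = holdingChain P fun _ => 1 / 2 := by
  ext x y
  by_cases h : x = y
  · subst h; simp [lazyVersion, holdingChain]; ring
  · simp [lazyVersion, holdingChain, h, Ne.symm h]; norm_num

/-- The source of the time change: dividing this identity for two holding functions eliminates `P`.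
-/
lemma sub_holdingChain_mulVec (P : Matrix E E ℝ) (a f : E → ℝ) (x : E) :
    (f - holdingChain P a *ᵥ f) x = (1 - a x) * (f - P *ᵥ f) x := by
  have : (holdingChain P a *ᵥ f) x = a x * f x + (1 - a x) * (P *ᵥ f) x := by
    simp [holdingChain, mulVec, dotProduct, add_mul, sum_add_distrib, mul_sum, mul_assoc]
  rw [Pi.sub_apply, this, Pi.sub_apply]
  ring

lemma holdingChain_mem_rowStochastic (hP : P ∈ rowStochastic ℝ E) (ha : ∀ x, 0 ≤ a x ∧ a x ≤ 1) :
    holdingChain P a ∈ rowStochastic ℝ E := by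
  refine ⟨fun x y => ?_, ?_⟩
  · have h1 := mul_nonneg (sub_nonneg.2 (ha x).2) (hP.1 x y)
    have h2 : 0 ≤ if y = x then a x else 0 := by
      split_ifs
      exacts [(ha x).1, le_rfl]
    exact add_nonneg h2 h1
  · ext x
    have := sub_holdingChain_mulVec P a 1 x
    rw [hP.2, sub_self, Pi.zero_apply, mul_zero, Pi.sub_apply] at this
    linarith

/-- The stationary distribution of the holding chain. -/
def holdingDistribution (π a : E → ℝ) (x : E) : ℝ := π x / (1 - a x) / ∑ y, π y / (1 - a y)

variable {π : E → ℝ}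

/-- The weight `π x / (1 - a x)` cancels the slowed jump rate, so the off-diagonal flow is
proportional to that of `P`. -/
lemma isReversibleWrt_holdingChain [Nonempty E] (h : IsReversibleWrt P π)
    (ha : ∀ x, 0 ≤ a x ∧ a x < 1) :
    IsReversibleWrt (holdingChain P a) (holdingDistribution π a) := by
  have hpos : ∀ x, 0 < π x / (1 - a x) := fun x =>
    div_pos (h.pos x) (by linarith [(ha x).2])
  have hZ : 0 < ∑ y, π y / (1 - a y) := sum_pos (fun x _ => hpos x) univ_nonempty
  refine ⟨holdingChain_mem_rowStochastic h.stochastic fun x => ⟨(ha x).1, (ha x).2.le⟩,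
    fun x => div_pos (hpos x) hZ, ?_, fun x y => ?_⟩
  · simp only [holdingDistribution, ← sum_div]
    exact div_self hZ.ne'
  · by_cases hxy : x = y
    · subst hxy; rfl
    have hx : 1 - a x ≠ 0 := by linarith [(ha x).2] |> ne_of_gt
    have hy : 1 - a y ≠ 0 := by linarith [(ha y).2] |> ne_of_gt
    simp only [holdingDistribution, holdingChain, of_apply, hxy, Ne.symm hxy, if_false, zero_add]
    have := h.balance x y
    field_simp
    linarith

lemma holdingChain_harmonic_const [Nonempty E] (hP : P ∈ rowStochastic ℝ E)
    (hirr : P.IsIrreducible) (ha : ∀ x, a x < 1) (f : E → ℝ) (hf : holdingChain P a *ᵥ f = f)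
    (x y : E) : f x = f y := by
  refine eq_of_mulVec_eq_self hP hirr ?_ x y
  ext z
  have h1 := sub_holdingChain_mulVec P a f z
  rw [hf, sub_self, Pi.zero_apply, eq_comm, mul_eq_zero, Pi.sub_apply] at h1
  rcases h1 with h1 | h1
  · linarith [ha z]
  · linarith

lemma stationaryDistribution_holdingChain [Nonempty E] (h : IsReversibleWrt P π)
    (hirr : P.IsIrreducible) (ha : ∀ x, 0 ≤ a x ∧ a x < 1) :
    stationaryDistribution (holdingChain P a) = holdingDistribution π a :=
  (isReversibleWrt_holdingChain h ha).stationaryDistribution_eq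
    (holdingChain_harmonic_const h.stochastic hirr fun x => (ha x).2)

lemma le_holdingChain_apply_self {c : ℝ} (hP : P ∈ rowStochastic ℝ E) (ha : ∀ x, c ≤ a x ∧ a x ≤ 1)
    (x : E) : c ≤ holdingChain P a x x := by
  have h1 := mul_nonneg (sub_nonneg.2 (ha x).2) (hP.1 x x)
  simp only [holdingChain, of_apply, if_true]
  linarith [(ha x).1]

lemma exists_worstDist_holdingChain_le [Nonempty E] {c : ℝ} (hc : 0 < c)
    (h : IsReversibleWrt P π) (hirr : P.IsIrreducible) (ha : ∀ x, c ≤ a x ∧ a x < 1) :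
    ∃ t, worstDist (holdingChain P a) (stationaryDistribution (holdingChain P a)) t ≤ 1 / 4 := by
  have ha' : ∀ x, 0 ≤ a x ∧ a x < 1 := fun x => ⟨hc.le.trans (ha x).1, (ha x).2⟩
  rw [stationaryDistribution_holdingChain h hirr ha']
  exact (isReversibleWrt_holdingChain h ha').exists_worstDist_le hc
    (le_holdingChain_apply_self h.stochastic fun x => ⟨(ha x).1, (ha x).2.le⟩)
    (holdingChain_harmonic_const h.stochastic hirr fun x => (ha x).2) (by norm_num)

/-- Both the unnormalized density and the normalizing sum lie between 1 and `1 / (1 - d)`. -/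
lemma holdingDistribution_bounds {d : ℝ} (h : IsReversibleWrt P π) (hd : d < 1)
    (ha : ∀ x, 0 ≤ a x ∧ a x ≤ d) (x : E) :
    (1 - d) * π x ≤ holdingDistribution π a x ∧ holdingDistribution π a x ≤ π x / (1 - d) := by
  have hd' : 0 < 1 - d := by linarith
  have hlow : ∀ x, π x ≤ π x / (1 - a x) := fun x => by
    rw [le_div_iff₀ (by linarith [(ha x).2])]
    nlinarith [(ha x).1, h.pos x]
  have hupp : ∀ x, π x / (1 - a x) ≤ π x / (1 - d) := fun x =>
    div_le_div_of_nonneg_left (h.pos x).le hd' (by linarith [(ha x).2])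
  have hZ1 : 1 ≤ ∑ y, π y / (1 - a y) := by
    exact h.sum_eq_one.symm.le.trans (sum_le_sum fun y _ => hlow y)
  have hZ2 : ∑ y, π y / (1 - a y) ≤ 1 / (1 - d) := by
    refine (sum_le_sum fun y _ => hupp y).trans_eq ?_
    rw [← sum_div, h.sum_eq_one]
  have hx := h.pos x
  constructor
  · rw [holdingDistribution, le_div_iff₀ (by linarith)]
    calc (1 - d) * π x * ∑ y, π y / (1 - a y) ≤ (1 - d) * π x * (1 / (1 - d)) := by gcongr
      _ = π x := by field_simp
      _ ≤ _ := hlow x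
  · exact (div_le_self ((h.pos x).le.trans (hlow x)) hZ1).trans (hupp x)

lemma isTimeChange_holdingChain [Nonempty E] {c d : ℝ} (hc : 0 < c) (hd : d < 1)
    (h : IsReversibleWrt P π) (ha : ∀ x, c ≤ a x ∧ a x ≤ d) (hb : ∀ x, c ≤ b x ∧ b x ≤ d) :
    IsTimeChange (holdingChain P a) (holdingChain P b) (holdingDistribution π a)
      (holdingDistribution π b) (fun x => (1 - b x) / (1 - a x)) (1 / (1 - d) ^ 2) c := by
  have hd' : 0 < 1 - d := by linarith
  obtain ⟨z⟩ := ‹Nonempty E›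
  have hcd : c ≤ d := (ha z).1.trans (ha z).2
  have hsq : (1 - d) ^ 2 ≤ 1 - d := by nlinarith
  have rate : ∀ {a b : E → ℝ}, (∀ x, c ≤ a x ∧ a x ≤ d) → (∀ x, c ≤ b x ∧ b x ≤ d) →
      ∀ x, (1 - b x) / (1 - a x) ≤ 1 / (1 - d) ^ 2 := fun ha hb x =>
    div_le_div₀ zero_le_one (by linarith [(hb x).1]) (by positivity) (by linarith [(ha x).2])
  have bound : ∀ {a b : E → ℝ}, (∀ x, c ≤ a x ∧ a x ≤ d) → (∀ x, c ≤ b x ∧ b x ≤ d) →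
      ∀ x, holdingDistribution π a x ≤ 1 / (1 - d) ^ 2 * holdingDistribution π b x :=
    fun {a b} ha hb x => by
      have h1 := (holdingDistribution_bounds h hd (fun x => ⟨hc.le.trans (ha x).1, (ha x).2⟩) x).2
      have h2 := (holdingDistribution_bounds h hd (fun x => ⟨hc.le.trans (hb x).1, (hb x).2⟩) x).1
      calc holdingDistribution π a x ≤ π x / (1 - d) := h1
        _ = 1 / (1 - d) ^ 2 * ((1 - d) * π x) := by field_simp
        _ ≤ _ := by gcongr
  have rev : ∀ {a : E → ℝ}, (∀ x, c ≤ a x ∧ a x ≤ d) →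
      IsReversibleWrt (holdingChain P a) (holdingDistribution π a) := fun ha =>
    have : Nonempty E := ⟨z⟩
    isReversibleWrt_holdingChain h fun x => ⟨hc.le.trans (ha x).1, (ha x).2.trans_lt hd⟩
  refine ⟨rev ha, rev hb, fun f x => ?_, ?_, rate ha hb, fun x => ?_, bound ha hb, bound hb ha, hc,
    hcd.trans_lt hd,
    le_holdingChain_apply_self h.stochastic fun x => ⟨(hb x).1, (hb x).2.trans hd.le⟩⟩
  · rw [sub_holdingChain_mulVec, sub_holdingChain_mulVec, ← mul_assoc,
      div_mul_cancel₀ _ (by linarith [(ha x).2] |> ne_of_gt)]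
  · rw [le_div_iff₀ (by positivity)]; linarith
  · have h1 := rate hb ha x
    have hax : 0 < 1 - a x := by linarith [(ha x).2]
    have hbx : 0 < 1 - b x := by linarith [(hb x).2]
    calc (1 : ℝ) = (1 - a x) / (1 - b x) * ((1 - b x) / (1 - a x)) := by field_simp
      _ ≤ _ := by gcongr

/-- The case `T = 0`, where the gap estimate is unavailable. Being mixed at time 0 forces every
function to be constant, since a centered one is bounded by half its own maximum. -/
lemma IsTimeChange.worstDist_zero_le [Nonempty E] {Q R : Matrix E E ℝ} {μ ν g : E → ℝ} {C c : ℝ}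
    (h : IsTimeChange Q R μ ν g C c) (hd : worstDist Q μ 0 ≤ 1 / 4) : worstDist R ν 0 ≤ 1 / 4 := by
  refine worstDist_le_of_forall h.right fun f _ hf0 x => ?_
  let ψ := f - fun _ => weightedInner μ f 1
  have hψ0 : ∑ y, μ y * ψ y = 0 := by
    have := h.left.weightedInner_center_one f
    rw [← this, weightedInner]
    simp only [Pi.one_apply, mul_one, ψ]
  obtain ⟨z, hz⟩ := Finite.exists_max fun y => |ψ y|
  have h1 := abs_pow_mulVec_sub_le hd hz (abs_nonneg _) z
  rw [hψ0, sub_zero, pow_zero, one_mulVec] at h1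
  have hf : f = fun _ => weightedInner μ f 1 := by
    ext y
    have h2 : ψ y = 0 := abs_nonpos_iff.1 ((hz y).trans (by linarith))
    exact sub_eq_zero.1 h2
  rw [hf, h.right.weightedInner_const_one] at hf0
  rw [hf, hf0, pow_zero, one_mulVec]
  norm_num

/-- The mixing time of the chain with holding probabilities `b` is at most a constant times the one
of the chain with holding probabilities `a`. -/
lemma mixingTime_holdingChain_le [Nonempty E] {c d : ℝ} (hc : 0 < c) (hd : d < 1)
    (h : IsReversibleWrt P π) (hirr : P.IsIrreducible) (ha : ∀ x, c ≤ a x ∧ a x ≤ d)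
    (hb : ∀ x, c ≤ b x ∧ b x ≤ d) {m : ℕ} (hm : 2048 * (1 / (1 - d) ^ 2) ^ 4 / c ^ 3 ≤ m) :
    mixingTime (holdingChain P b) (1 / 4) ≤ 2 * m * mixingTime (holdingChain P a) (1 / 4) := by
  have ht := isTimeChange_holdingChain hc hd h ha hb
  have hmem : worstDist (holdingChain P a) (stationaryDistribution (holdingChain P a))
      (mixingTime (holdingChain P a) (1 / 4)) ≤ 1 / 4 :=
    Nat.sInf_mem (s := {t : ℕ | worstDist (holdingChain P a)
        (stationaryDistribution (holdingChain P a)) t ≤ 1 / 4})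
      (exists_worstDist_holdingChain_le hc h hirr fun x => ⟨(ha x).1, (ha x).2.trans_lt hd⟩)
  rw [stationaryDistribution_holdingChain h hirr fun x =>
    ⟨hc.le.trans (ha x).1, (ha x).2.trans_lt hd⟩] at hmem
  refine Nat.sInf_le ?_
  rw [Set.mem_ofPred_eq, stationaryDistribution_holdingChain h hirr fun x =>
    ⟨hc.le.trans (hb x).1, (hb x).2.trans_lt hd⟩]
  rcases Nat.eq_zero_or_pos (mixingTime (holdingChain P a) (1 / 4)) with h0 | h0
  · rw [h0] at hmem ⊢
    exact ht.worstDist_zero_le hmem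
  · exact ht.worstDist_le h0 hm hmem

end holding

end MarkovMixing

end

/-! ### The two-sided comparison -/

open MarkovMixing in
theorem mainTheorem9 (c₁ c₂ : ℝ) (hc₁ : c₁ ∈ Set.Ioo (0 : ℝ) 1)
    (hc₂ : c₂ ∈ Set.Ioo (0 : ℝ) 1) :
    ∃ c c' : ℝ, 0 < c ∧ 0 < c' ∧
      ∀ (E : Type u) [Fintype E] [DecidableEq E] [Nonempty E]
        (P : Matrix E E ℝ) (a : E → ℝ),
        P ∈ Matrix.rowStochastic ℝ E → P.IsIrreducible → MarkovMixing.IsReversible P →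
        (∀ x, a x ∈ Set.Icc c₁ c₂) →
        (∃ t : ℕ, MarkovMixing.worstDist (MarkovMixing.lazyVersion P)
          (MarkovMixing.stationaryDistribution P) t ≤ 1 / 4) ∧
        (∃ t : ℕ, MarkovMixing.worstDist (MarkovMixing.holdingChain P a)
          (MarkovMixing.stationaryDistribution (MarkovMixing.holdingChain P a)) t ≤ 1 / 4) ∧
        c * (MarkovMixing.lazyMixingTime P (1 / 4) : ℝ) ≤
          (MarkovMixing.mixingTime (MarkovMixing.holdingChain P a) (1 / 4) : ℝ) ∧
        (MarkovMixing.mixingTime (MarkovMixing.holdingChain P a) (1 / 4) : ℝ) ≤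
          c' * (MarkovMixing.lazyMixingTime P (1 / 4) : ℝ) := by
  -- The interval from `c` to `d` contains both the values of `a` and the lazy holding probability
  -- 1/2.
  set c := min c₁ (1 / 2) with hcdef
  set d := max c₂ (1 / 2) with hddef
  have hc : 0 < c := lt_min hc₁.1 (by norm_num)
  have hd : d < 1 := max_lt hc₂.2 (by norm_num)
  obtain ⟨n, hn⟩ := exists_nat_ge (2048 * (1 / (1 - d) ^ 2) ^ 4 / c ^ 3)
  set m := n + 1
  have hm : 2048 * (1 / (1 - d) ^ 2) ^ 4 / c ^ 3 ≤ (m : ℕ) := by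
    simp only [m]; push_cast; linarith
  have hm0 : (0 : ℝ) < (m : ℕ) := by exact_mod_cast n.succ_pos
  refine ⟨1 / (2 * m), 2 * m, by positivity, by positivity, ?_⟩
  intro E _ _ _ P a hP hirr hrev ha
  obtain ⟨π, hπ, hbal⟩ := hrev
  have h : IsReversibleWrt P π := ⟨hP, hπ.pos hirr, hπ.sum_eq_one, hbal⟩
  have ha' : ∀ x, c ≤ a x ∧ a x ≤ d := fun x =>
    ⟨(min_le_left _ _).trans (ha x).1, (ha x).2.trans (le_max_left _ _)⟩
  have hb : ∀ x : E, c ≤ (fun _ => 1 / 2 : E → ℝ) x ∧ (fun _ => 1 / 2 : E → ℝ) x ≤ d := fun x =>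
    ⟨min_le_right _ _, le_max_right _ _⟩
  -- A constant holding probability cancels in the normalization.
  have hstat : stationaryDistribution P = stationaryDistribution (lazyVersion P) := by
    rw [lazyVersion_eq_holdingChain, stationaryDistribution_holdingChain h hirr
      (fun _ => ⟨by norm_num, by norm_num⟩),
      h.stationaryDistribution_eq fun f hf => eq_of_mulVec_eq_self hP hirr hf]
    ext x
    simp only [holdingDistribution, ← Finset.sum_div, h.sum_eq_one]
    ring
  have hlazy : lazyMixingTime P (1 / 4) = mixingTime (lazyVersion P) (1 / 4) := by
    rw [lazyMixingTime, mixingTime, hstat]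
  rw [hlazy, hstat, lazyVersion_eq_holdingChain]
  refine ⟨exists_worstDist_holdingChain_le hc h hirr fun x => ⟨(hb x).1, (hb x).2.trans_lt hd⟩,
    exists_worstDist_holdingChain_le hc h hirr fun x => ⟨(ha' x).1, (ha' x).2.trans_lt hd⟩, ?_, ?_⟩
  · rw [one_div_mul_eq_div, div_le_iff₀ (by positivity), mul_comm]
    exact_mod_cast mixingTime_holdingChain_le hc hd h hirr ha' hb hm
  · exact_mod_cast mixingTime_holdingChain_le hc hd h hirr hb ha' hm
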